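/- Let $\Omega_+\subset\mathbb R^3$ be a bounded domain with $C^2$-smooth boundary $\Sigma$, let $\Omega_-=\mathbb R^3\setminus\overline{\Omega_+}$, let $\nu$ be the unit normal vector field on $\Sigma$ pointing outwards $\Omega_+$, and let $m,c>0$ and $\eta,\tau\in\mathbb R$. Let $\alpha_1,\alpha_2,\alpha_3,\beta\in\mathbb C^{4\times4}$ be the Dirac matrices $$\alpha_j=\begin{pmatrix}0&\sigma_j\\ \sigma_j&0\end{pmatrix},\qquad \beta=\begin{pmatrix}I_2&0\\0&-I_2\end{pmatrix},$$ with the Pauli matrices $\sigma_1=\begin{pmatrix}0&1\\1&0\end{pmatrix}$, $\sigma_2=\begin{pmatrix}0&-i\\i&0\end{pmatrix}$, $\sigma_3=\begin{pmatrix}1&0\\0&-1\end{pmatrix}$, and put $\alpha\cdot x=\sum_{k=1}^3 x_k\alpha_k$ for $x\in\mathbb R^3$ and $\alpha\cdot\nabla=\sum_{k=1}^3\alpha_k\partial_k$. For $f\in L^2(\mathbb R^3)^4=L^2(\Omega_+)^4\oplus L^2(\Omega_-)^4$ write $f=f_+\oplus f_-$ with $f_\pm=f\upharpoonright\Omega_\pm$,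 and let $f_\pm|_\Sigma$ denote the trace of $f_\pm\in H^1(\Omega_\pm)^4$ on $\Sigma$. Identities between traces are understood in $L^2(\Sigma)^4$, that is, almost everywhere with respect to the surface measure. Let $A_{\eta,\tau}$ be the operator in $L^2(\mathbb R^3)^4$ given by $$A_{\eta,\tau}f=(-ic\,\alpha\cdot\nabla+mc^2\beta)f_+\oplus(-ic\,\alpha\cdot\nabla+mc^2\beta)f_-$$ on the domain of all $f=f_+\oplus f_-\in H^1(\Omega_+)^4\oplus H^1(\Omega_-)^4$ with $$ic(\alpha\cdot\nu)(f_+|_\Sigma-f_-|_\Sigma)+\tfrac12(\eta I_4+\tau\beta)(f_+|_\Sigma+f_-|_\Sigma)=0 .$$ (i) If $\eta^2-\tau^2\neq-4c^2$, then at every point of $\Sigma$ the matrix $ic(\alpha\cdot\nu)+\frac12(\eta I_4+\tau\beta)$ and the matrix $$R_{\eta,\tau}:=-\Big(ic(\alpha\cdot\nu)+\tfrac12(\eta I_4+\tau\beta)\Big)^{-1}\Big(-ic(\alpha\cdot\nu)+\tfrac12(\eta I_4+\tau\beta)\Big)$$ are invertible, and a function $f=f_+\oplus f_-\in H^1(\Omega_+)^4\oplus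 H^1(\Omega_-)^4$ belongs to $\operatorname{dom}A_{\eta,\tau}$ if and only if $f_+|_\Sigma=R_{\eta,\tau}\,f_-|_\Sigma$. (ii) If $\eta^2-\tau^2=-4c^2$, then a function $f=f_+\oplus f_-\in H^1(\Omega_+)^4\oplus H^1(\Omega_-)^4$ belongs to $\operatorname{dom}A_{\eta,\tau}$ if and only if $$\big(2cI_4-i(\alpha\cdot\nu)(\eta I_4+\tau\beta)\big)f_+|_\Sigma=0\quad\text{and}\quad\big(2cI_4+i(\alpha\cdot\nu)(\eta I_4+\tau\beta)\big)f_-|_\Sigma=0 .$$ Hence $A_{\eta,\tau}$ is the orthogonal sum of the two operators $-ic\,\alpha\cdot\nabla+mc^2\beta$ in $L^2(\Omega_\pm)^4$ whose domains consist of all $f_\pm\in H^1(\Omega_\pm)^4$ satisfying the respective one of these boundary conditions. (iii) In particular, for $\eta=0$ and $\tau=2c$ these boundary conditions are equivalent to the MIT bag boundary conditions $$\big(I_4+i\beta(\alpha\cdot\nu)\big)f_+|_\Sigma=0,\qquad\big(I_4-i\beta(\alpha\cdot\nu)\big)f_-|_\Sigma=0,$$ and $A_{0,2c}$ is the orthogonal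 sum of the operators $-ic\,\alpha\cdot\nabla+mc^2\beta$ in $L^2(\Omega_\pm)^4$ with these boundary conditions. -/

import Mathlib

open MeasureTheory TopologicalSpace Set
open scoped ContDiff Gradient Matrix

noncomputable section

namespace DeltaShell

/-- The Euclidean space `ℝ³`. -/
abbrev Space : Type := EuclideanSpace ℝ (Fin 3)

/-- The spinor space `ℂ⁴` with its Hermitian norm. -/
abbrev Spinor : Type := EuclideanSpace ℂ (Fin 4)

/-- Complex `4 × 4` matrices. -/
abbrev Mat4 : Type := Matrix (Fin 4) (Fin 4) ℂ

/-! ### Dirac matrices -/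

/-- The Pauli spin matrices `σ₁, σ₂, σ₃`. -/
def pauli : Fin 3 → Matrix (Fin 2) (Fin 2) ℂ :=
  ![!![0, 1; 1, 0], !![0, -Complex.I; Complex.I, 0], !![1, 0; 0, -1]]

/-- The Dirac matrices `α₁, α₂, α₃`, in block form `(0, σⱼ; σⱼ, 0)`. -/
def diracAlpha (j : Fin 3) : Mat4 :=
  Matrix.reindex finSumFinEquiv finSumFinEquiv
    (Matrix.fromBlocks 0 (pauli j) (pauli j) 0)

/-- The Dirac matrix `β`, in block form `(I₂, 0; 0, -I₂)`. -/
def diracBeta : Mat4 :=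
  Matrix.reindex finSumFinEquiv finSumFinEquiv
    (Matrix.fromBlocks (1 : Matrix (Fin 2) (Fin 2) ℂ) 0 0 (-1 : Matrix (Fin 2) (Fin 2) ℂ))

/-- `α · x = α₁ x₁ + α₂ x₂ + α₃ x₃` for `x ∈ ℝ³`. -/
def alphaDot (x : Space) : Mat4 := ∑ k : Fin 3, (x k : ℂ) • diracAlpha k

/-- The matrix `η I₄ + τ β`. -/
def strength (η τ : ℝ) : Mat4 := (η : ℂ) • (1 : Mat4) + (τ : ℂ) • diracBeta

/-! ### Domains with `C²` boundary and their unit normal -/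

/-- `φ` is a `C²` defining function of `Ω` on the open neighbourhood `U` of `x`: its gradient does
not vanish on `U`, and inside `U` the set `Ω` is the set where `φ` is negative. -/
structure IsLocalDefiningFunction (Ω : Set Space) (x : Space) (U : Set Space) (φ : Space → ℝ) :
    Prop where
  isOpen : IsOpen U
  mem : x ∈ U
  contDiffOn : ContDiffOn ℝ 2 φ U
  gradient_ne_zero : ∀ y ∈ U, ∇ φ y ≠ 0
  mem_iff : ∀ y ∈ U, y ∈ Ω ↔ φ y < 0

/-- A bounded domain (nonempty connected open set) of `ℝ³` with `C²`-smooth boundary. -/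
structure IsBoundedC2Domain (Ω : Opens Space) : Prop where
  isConnected : IsConnected (Ω : Set Space)
  isBounded : Bornology.IsBounded (Ω : Set Space)
  smooth_boundary : ∀ x ∈ frontier (Ω : Set Space),
    ∃ (U : Set Space) (φ : Space → ℝ), IsLocalDefiningFunction Ω x U φ

/-- `n` is the unit normal of `∂Ω` at the boundary point `x` pointing outwards `Ω`. -/
def IsOutwardUnitNormal (Ω : Set Space) (x n : Space) : Prop :=
  ∃ (U : Set Space) (φ : Space → ℝ),
    IsLocalDefiningFunction Ω x U φ ∧ n = ‖∇ φ x‖⁻¹ • ∇ φ x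

open Classical in
/-- The unit normal vector field `ν` on `∂Ω` pointing outwards `Ω` (`0` where there is none; at the
boundary points of a `C²` domain it exists and is unique). -/
def outwardNormal (Ω : Set Space) (x : Space) : Space :=
  if h : ∃ n, IsOutwardUnitNormal Ω x n then h.choose else 0

/-- The exterior domain `Ω₋ = ℝ³ ∖ closure Ω₊`. -/
def exterior (Ω : Opens Space) : Opens Space :=
  ⟨(closure (Ω : Set Space))ᶜ, isClosed_closure.isOpen_compl⟩

/-- The boundary surface `Σ = ∂Ω`. -/
def surface (Ω : Opens Space) : Set Space := frontier (Ω : Set Space)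

/-- The surface measure on `S`: the two-dimensional Hausdorff measure, normalized so that it is
the Lebesgue measure on planes. -/
def surfaceMeasure (S : Set Space) : Measure Space := μHE[2].restrict S

/-! ### `L²` and Sobolev spaces -/

/-- `L²(μ)⁴`, the square integrable `ℂ⁴`-valued functions. -/
abbrev L2 (μ : Measure Space) : Type := Lp Spinor 2 μ

/-- `L²(Ω)⁴`. -/
abbrev L2On (Ω : Opens Space) : Type := L2 (volume.restrict (Ω : Set Space))

/-- `L²(S)⁴` with respect to the surface measure. -/
abbrev L2Surface (S : Set Space) : Type := L2 (surfaceMeasure S)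

/-- The partial derivative `∂ⱼ φ`. -/
def partialDeriv (j : Fin 3) (φ : Space → ℝ) (x : Space) : ℝ :=
  fderiv ℝ φ x (EuclideanSpace.single j 1)

/-- `φ ∈ C₀^∞(Ω)`, real-valued. -/
structure IsTestFunction (Ω : Set Space) (φ : Space → ℝ) : Prop where
  contDiff : ContDiff ℝ ∞ φ
  compact : HasCompactSupport φ
  subset : tsupport φ ⊆ Ω

/-- `g` is the distributional derivative `∂ⱼ f` on `Ω`. -/
def IsWeakDeriv (Ω : Opens Space) (j : Fin 3) (f g : L2On Ω) : Prop :=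
  ∀ φ : Space → ℝ, IsTestFunction Ω φ →
    ∫ x in (Ω : Set Space), partialDeriv j φ x • f x =
      -∫ x in (Ω : Set Space), φ x • g x

theorem IsTestFunction.continuous_partialDeriv {Ω : Set Space} {φ : Space → ℝ}
    (h : IsTestFunction Ω φ) (j : Fin 3) : Continuous (partialDeriv j φ) :=
  (h.contDiff.continuous_fderiv (by simp)).clm_apply continuous_const

theorem IsTestFunction.compact_partialDeriv {Ω : Set Space} {φ : Space → ℝ}
    (h : IsTestFunction Ω φ) (j : Fin 3) : HasCompactSupport (partialDeriv j φ) :=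
  (h.compact.fderiv (𝕜 := ℝ)).comp_left
    (g := fun L : Space →L[ℝ] ℝ => L (EuclideanSpace.single j 1)) rfl

theorem L2On.locallyIntegrable {Ω : Opens Space} (f : L2On Ω) :
    LocallyIntegrable f (volume.restrict (Ω : Set Space)) :=
  (Lp.memLp f).locallyIntegrable (by norm_num)

theorem L2On.integrable_smul {Ω : Opens Space} (f : L2On Ω) {φ : Space → ℝ}
    (hc : Continuous φ) (hs : HasCompactSupport φ) :
    Integrable (fun x => φ x • f x) (volume.restrict (Ω : Set Space)) :=
  (L2On.locallyIntegrable f).integrable_smul_left_of_hasCompactSupport hc hs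

theorem IsWeakDeriv.add {Ω : Opens Space} {j : Fin 3} {f g f' g' : L2On Ω}
    (h : IsWeakDeriv Ω j f g) (h' : IsWeakDeriv Ω j f' g') :
    IsWeakDeriv Ω j (f + f') (g + g') := by
  intro φ hφ
  have e1 : ∫ x in (Ω : Set Space), partialDeriv j φ x • (f + f' : L2On Ω) x
      = ∫ x in (Ω : Set Space), (partialDeriv j φ x • f x + partialDeriv j φ x • f' x) := by
    apply integral_congr_ae
    filter_upwards [Lp.coeFn_add f f'] with x hx
    rw [hx, Pi.add_apply, smul_add]
  have e2 : ∫ x in (Ω : Set Space), φ x • (g + g' : L2On Ω) x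
      = ∫ x in (Ω : Set Space), (φ x • g x + φ x • g' x) := by
    apply integral_congr_ae
    filter_upwards [Lp.coeFn_add g g'] with x hx
    rw [hx, Pi.add_apply, smul_add]
  have c1 := hφ.continuous_partialDeriv j
  have c2 := hφ.compact_partialDeriv j
  have c3 := hφ.contDiff.continuous
  rw [e1, e2, integral_add (L2On.integrable_smul f c1 c2) (L2On.integrable_smul f' c1 c2),
    integral_add (L2On.integrable_smul g c3 hφ.compact) (L2On.integrable_smul g' c3 hφ.compact),
    h φ hφ, h' φ hφ, neg_add]

theorem IsWeakDeriv.smul {Ω : Opens Space} {j : Fin 3} {f g : L2On Ω} (a : ℂ)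
    (h : IsWeakDeriv Ω j f g) : IsWeakDeriv Ω j (a • f) (a • g) := by
  intro φ hφ
  have e1 : ∫ x in (Ω : Set Space), partialDeriv j φ x • (a • f : L2On Ω) x
      = ∫ x in (Ω : Set Space), a • (partialDeriv j φ x • f x) := by
    apply integral_congr_ae
    filter_upwards [Lp.coeFn_smul a f] with x hx
    rw [hx, Pi.smul_apply, smul_comm]
  have e2 : ∫ x in (Ω : Set Space), φ x • (a • g : L2On Ω) x
      = ∫ x in (Ω : Set Space), a • (φ x • g x) := by
    apply integral_congr_ae
    filter_upwards [Lp.coeFn_smul a g] with x hx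
    rw [hx, Pi.smul_apply, smul_comm]
  rw [e1, e2, integral_smul, integral_smul, h φ hφ, smul_neg]

theorem IsWeakDeriv.zero (Ω : Opens Space) (j : Fin 3) : IsWeakDeriv Ω j 0 0 := by
  intro φ _
  have e : ∀ ψ : Space → ℝ, ∫ x in (Ω : Set Space), ψ x • (0 : L2On Ω) x = 0 := by
    intro ψ
    rw [← integral_zero Space Spinor (μ := volume.restrict (Ω : Set Space))]
    apply integral_congr_ae
    filter_upwards [Lp.coeFn_zero Spinor 2 (volume.restrict (Ω : Set Space))] with x hx
    rw [hx, Pi.zero_apply, smul_zero]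
  rw [e, e, neg_zero]

theorem IsWeakDeriv.unique {Ω : Opens Space} {j : Fin 3} {f g g' : L2On Ω}
    (h : IsWeakDeriv Ω j f g) (h' : IsWeakDeriv Ω j f g') : g = g' := by
  have key : ∀ᵐ x ∂(volume : Measure Space), x ∈ (Ω : Set Space) → g x - g' x = 0 := by
    refine Ω.isOpen.ae_eq_zero_of_integral_contDiff_smul_eq_zero ?_ ?_
    · exact locallyIntegrableOn_of_locallyIntegrable_restrict
        ((L2On.locallyIntegrable g).sub (L2On.locallyIntegrable g'))
    · intro φ h1 h2 h3
      have hφ : IsTestFunction Ω φ := ⟨h1, h2, h3⟩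
      have e0 : ∫ x, φ x • (g x - g' x) = ∫ x in (Ω : Set Space), φ x • (g x - g' x) := by
        refine (setIntegral_eq_integral_of_forall_compl_eq_zero fun x hx => ?_).symm
        rw [image_eq_zero_of_notMem_tsupport fun hx' => hx (h3 hx'), zero_smul]
      have e1 := (h φ hφ).symm.trans (h' φ hφ)
      simp only [smul_sub]
      simp only [smul_sub] at e0
      rw [e0, integral_sub (L2On.integrable_smul g h1.continuous h2)
        (L2On.integrable_smul g' h1.continuous h2), neg_injective e1, sub_self]
  apply Lp.ext
  filter_upwards [(ae_restrict_iff' Ω.isOpen.measurableSet).2 key] with x hx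
  exact sub_eq_zero.1 hx

/-- The Sobolev space `H¹(Ω)⁴`. -/
def H1 (Ω : Opens Space) : Submodule ℂ (L2On Ω) where
  carrier := {f | ∀ j : Fin 3, ∃ g : L2On Ω, IsWeakDeriv Ω j f g}
  add_mem' hf hf' j :=
    let ⟨g, hg⟩ := hf j
    let ⟨g', hg'⟩ := hf' j
    ⟨g + g', hg.add hg'⟩
  zero_mem' j := ⟨0, IsWeakDeriv.zero Ω j⟩
  smul_mem' a _ hf j :=
    let ⟨g, hg⟩ := hf j
    ⟨a • g, hg.smul a⟩

/-- The distributional derivative `∂ⱼ : H¹(Ω)⁴ → L²(Ω)⁴`. -/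
def weakDeriv (Ω : Opens Space) (j : Fin 3) : H1 Ω →ₗ[ℂ] L2On Ω where
  toFun f := (f.2 j).choose
  map_add' f f' := IsWeakDeriv.unique ((f + f').2 j).choose_spec
    ((f.2 j).choose_spec.add (f'.2 j).choose_spec)
  map_smul' a f := IsWeakDeriv.unique ((a • f).2 j).choose_spec
    ((f.2 j).choose_spec.smul a)

/-- The norm of `H¹(Ω)⁴`. -/
def h1Norm {Ω : Opens Space} (f : H1 Ω) : ℝ :=
  √(‖(f : L2On Ω)‖ ^ 2 + ∑ j : Fin 3, ‖weakDeriv Ω j f‖ ^ 2)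

/-! ### The trace on the boundary -/

/-- `T` is the trace operator on `S` of `H¹(Ω)⁴`: it is a bounded linear map into `L²(S)⁴` which
maps (the restriction to `Ω` of) every `u ∈ C₀^∞(ℝ³)⁴` to the restriction of `u` to `S`. -/
structure IsTraceOperator (Ω : Opens Space) (S : Set Space) (T : H1 Ω →ₗ[ℂ] L2Surface S) :
    Prop where
  bounded : ∃ C : ℝ, ∀ f : H1 Ω, ‖T f‖ ≤ C * h1Norm f
  smooth : ∀ u : Space → Spinor, ContDiff ℝ ∞ u → HasCompactSupport u →
    ∀ f : H1 Ω, (f : L2On Ω) =ᵐ[volume.restrict (Ω : Set Space)] u →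
      T f =ᵐ[surfaceMeasure S] u

open Classical in
/-- The trace `f ↦ f|_S`. For a domain `Ω` with compact `C²` boundary `S` there is exactly one
trace operator, by the trace theorem and the density of smooth functions in `H¹(Ω)`; if there is
none, the value is `0`. -/
def trace (Ω : Opens Space) (S : Set Space) : H1 Ω →ₗ[ℂ] L2Surface S :=
  if h : ∃ T, IsTraceOperator Ω S T then h.choose else 0

/-! ### Dirac operators -/

/-- A constant matrix acting on `L²(μ)⁴`. -/
def matrixAct (M : Mat4) (μ : Measure Space) : L2 μ →ₗ[ℂ] L2 μ :=
  ((Matrix.toEuclideanCLM (n := Fin 4) (𝕜 := ℂ) M).compLpL 2 μ : L2 μ →L[ℂ] L2 μ)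

/-- The differential expression `-i c α · ∇ f + m c² β f` for `f ∈ H¹(Ω)⁴`. -/
def diracExpr (Ω : Opens Space) (m c : ℝ) : H1 Ω →ₗ[ℂ] L2On Ω :=
  (-(Complex.I * c)) • ∑ j : Fin 3, matrixAct (diracAlpha j) _ ∘ₗ weakDeriv Ω j
    + ((m * c ^ 2 : ℝ) : ℂ) • matrixAct diracBeta _ ∘ₗ (H1 Ω).subtype

/-- The boundary condition `B g = 0` on `S`, for a matrix-valued function `B`. -/
def BoundaryCondition (S : Set Space) (B : Space → Mat4) (g : L2Surface S) : Prop :=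
  ∀ᵐ x ∂(surfaceMeasure S), B x *ᵥ (g x).ofLp = 0

theorem BoundaryCondition.add {S : Set Space} {B : Space → Mat4} {g g' : L2Surface S}
    (h : BoundaryCondition S B g) (h' : BoundaryCondition S B g') :
    BoundaryCondition S B (g + g') := by
  filter_upwards [h, h', Lp.coeFn_add g g'] with x h1 h2 h3
  rw [h3, Pi.add_apply, WithLp.ofLp_add, Matrix.mulVec_add, h1, h2, add_zero]

theorem BoundaryCondition.smul {S : Set Space} {B : Space → Mat4} {g : L2Surface S} (a : ℂ)
    (h : BoundaryCondition S B g) : BoundaryCondition S B (a • g) := by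
  filter_upwards [h, Lp.coeFn_smul a g] with x h1 h3
  rw [h3, Pi.smul_apply, WithLp.ofLp_smul, Matrix.mulVec_smul, h1, smul_zero]

theorem BoundaryCondition.zero (S : Set Space) (B : Space → Mat4) : BoundaryCondition S B 0 := by
  filter_upwards [Lp.coeFn_zero Spinor 2 (surfaceMeasure S)] with x h3
  rw [h3, Pi.zero_apply, WithLp.ofLp_zero, Matrix.mulVec_zero]

/-- The subspace `{f ∈ H¹(Ω)⁴ : B f|_S = 0}` of `L²(Ω)⁴`. -/
def boundaryDomain (Ω : Opens Space) (S : Set Space) (B : Space → Mat4) :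
    Submodule ℂ (L2On Ω) where
  carrier := {f | ∃ h : f ∈ H1 Ω, BoundaryCondition S B (trace Ω S ⟨f, h⟩)}
  add_mem' := by
    rintro f f' ⟨h, hB⟩ ⟨h', hB'⟩
    refine ⟨add_mem h h', ?_⟩
    have e : (⟨f + f', add_mem h h'⟩ : H1 Ω) = ⟨f, h⟩ + ⟨f', h'⟩ := rfl
    rw [e, map_add]
    exact hB.add hB'
  zero_mem' := by
    refine ⟨zero_mem _, ?_⟩
    have e : (⟨0, zero_mem _⟩ : H1 Ω) = 0 := rfl
    rw [e, map_zero]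
    exact BoundaryCondition.zero S B
  smul_mem' := by
    rintro a f ⟨h, hB⟩
    refine ⟨Submodule.smul_mem _ a h, ?_⟩
    have e : (⟨a • f, Submodule.smul_mem _ a h⟩ : H1 Ω) = a • ⟨f, h⟩ := rfl
    rw [e, map_smul]
    exact hB.smul a

theorem boundaryDomain_le (Ω : Opens Space) (S : Set Space) (B : Space → Mat4) :
    boundaryDomain Ω S B ≤ H1 Ω := fun _ hf => hf.1

/-- The Dirac operator `f ↦ -i c α · ∇ f + m c² β f` in `L²(Ω)⁴` with domain
`{f ∈ H¹(Ω)⁴ : B f|_S = 0}`, for a matrix-valued function `B` on `S`. -/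
def boundaryDirac (Ω : Opens Space) (S : Set Space) (m c : ℝ) (B : Space → Mat4) :
    L2On Ω →ₗ.[ℂ] L2On Ω where
  domain := boundaryDomain Ω S B
  toFun := diracExpr Ω m c ∘ₗ Submodule.inclusion (boundaryDomain_le Ω S B)

/-! ### The decomposition `L²(ℝ³)⁴ = L²(Ω₊)⁴ ⊕ L²(Ω₋)⁴` -/

/-- The restriction `f ↾ Ω` of `f ∈ L²(ℝ³)⁴`. -/
def restrictL2 (Ω : Opens Space) : L2 volume →ₗ[ℂ] L2On Ω :=
  (LpToLpRestrictCLM Space Spinor ℂ volume 2 (Ω : Set Space) : L2 volume →L[ℂ] L2On Ω)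

theorem memLp_indicator {Ω : Opens Space} (f : L2On Ω) :
    MemLp ((Ω : Set Space).indicator f) 2 (volume : Measure Space) :=
  (memLp_indicator_iff_restrict Ω.isOpen.measurableSet).2 (Lp.memLp f)

/-- The extension by zero of `f ∈ L²(Ω)⁴` to `ℝ³`. -/
def extendL2 (Ω : Opens Space) : L2On Ω →ₗ[ℂ] L2 volume where
  toFun f := (memLp_indicator f).toLp _
  map_add' f f' := by
    rw [← MemLp.toLp_add, MemLp.toLp_eq_toLp_iff]
    filter_upwards [(ae_restrict_iff' Ω.isOpen.measurableSet).1 (Lp.coeFn_add f f')] with x hx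
    by_cases h : x ∈ (Ω : Set Space)
    · simp only [Pi.add_apply, indicator_of_mem h]
      rw [hx h, Pi.add_apply]
    · simp only [Pi.add_apply, indicator_of_notMem h, add_zero]
  map_smul' a f := by
    rw [RingHom.id_apply, ← MemLp.toLp_const_smul, MemLp.toLp_eq_toLp_iff]
    filter_upwards [(ae_restrict_iff' Ω.isOpen.measurableSet).1 (Lp.coeFn_smul a f)] with x hx
    by_cases h : x ∈ (Ω : Set Space)
    · simp only [Pi.smul_apply, indicator_of_mem h]
      rw [hx h, Pi.smul_apply]
    · simp only [Pi.smul_apply, indicator_of_notMem h, smul_zero]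

/-- The function `f₊ ⊕ f₋` on `ℝ³` that is `f₊` in `Ω₊ = Ω` and `f₋` in `Ω₋`. -/
def glue (Ω : Opens Space) (fp : L2On Ω) (fm : L2On (exterior Ω)) : L2 volume :=
  extendL2 Ω fp + extendL2 (exterior Ω) fm

/-- The orthogonal sum `A₊ ⊕ A₋` of operators in `L²(Ω₊)⁴` and `L²(Ω₋)⁴`, as an operator in
`L²(ℝ³)⁴`. -/
def orthogonalSum (Ω : Opens Space) (Ap : L2On Ω →ₗ.[ℂ] L2On Ω)
    (Am : L2On (exterior Ω) →ₗ.[ℂ] L2On (exterior Ω)) : L2 volume →ₗ.[ℂ] L2 volume where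
  domain := Ap.domain.comap (restrictL2 Ω) ⊓ Am.domain.comap (restrictL2 (exterior Ω))
  toFun :=
    { toFun := fun f => glue Ω (Ap ⟨restrictL2 Ω f, f.2.1⟩)
        (Am ⟨restrictL2 (exterior Ω) f, f.2.2⟩)
      map_add' := fun f f' => by
        have e1 : (⟨restrictL2 Ω (f + f' : _), (f + f').2.1⟩ : Ap.domain)
            = ⟨restrictL2 Ω f, f.2.1⟩ + ⟨restrictL2 Ω f', f'.2.1⟩ :=
          Subtype.ext (map_add (restrictL2 Ω) f.1 f'.1)
        have e2 : (⟨restrictL2 (exterior Ω) (f + f' : _), (f + f').2.2⟩ : Am.domain)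
            = ⟨restrictL2 (exterior Ω) f, f.2.2⟩ + ⟨restrictL2 (exterior Ω) f', f'.2.2⟩ :=
          Subtype.ext (map_add (restrictL2 (exterior Ω)) f.1 f'.1)
        rw [e1, e2, Ap.map_add, Am.map_add]
        simp only [glue, map_add]
        abel
      map_smul' := fun a f => by
        have e1 : (⟨restrictL2 Ω (a • f : _), (a • f).2.1⟩ : Ap.domain)
            = a • ⟨restrictL2 Ω f, f.2.1⟩ :=
          Subtype.ext (map_smul (restrictL2 Ω) a f.1)
        have e2 : (⟨restrictL2 (exterior Ω) (a • f : _), (a • f).2.2⟩ : Am.domain)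
            = a • ⟨restrictL2 (exterior Ω) f, f.2.2⟩ :=
          Subtype.ext (map_smul (restrictL2 (exterior Ω)) a f.1)
        rw [e1, e2, Ap.map_smul, Am.map_smul]
        simp only [glue, map_smul, smul_add, RingHom.id_apply] }

/-- The space `H¹(Ω₊)⁴ ⊕ H¹(Ω₋)⁴`, as a subspace of `L²(ℝ³)⁴`. -/
def brokenH1 (Ω : Opens Space) : Submodule ℂ (L2 volume) :=
  (H1 Ω).comap (restrictL2 Ω) ⊓ (H1 (exterior Ω)).comap (restrictL2 (exterior Ω))

/-- `f ↦ f₊ = f ↾ Ω₊`. -/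
def plusPart (Ω : Opens Space) : brokenH1 Ω →ₗ[ℂ] H1 Ω :=
  (restrictL2 Ω).restrict fun _ h => h.1

/-- `f ↦ f₋ = f ↾ Ω₋`. -/
def minusPart (Ω : Opens Space) : brokenH1 Ω →ₗ[ℂ] H1 (exterior Ω) :=
  (restrictL2 (exterior Ω)).restrict fun _ h => h.2

/-- The boundary values `f₊|_Σ` from inside. -/
def tracePlus (Ω : Opens Space) : brokenH1 Ω →ₗ[ℂ] L2Surface (surface Ω) :=
  trace Ω (surface Ω) ∘ₗ plusPart Ω

/-- The boundary values `f₋|_Σ` from outside. -/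
def traceMinus (Ω : Opens Space) : brokenH1 Ω →ₗ[ℂ] L2Surface (surface Ω) :=
  trace (exterior Ω) (surface Ω) ∘ₗ minusPart Ω

/-! ### The Dirac operator with a `δ`-shell interaction -/

/-- The matrix `α · ν` at the boundary points of `Ω`. -/
def alphaNu (Ω : Opens Space) (x : Space) : Mat4 := alphaDot (outwardNormal Ω x)

/-- The coupling condition
`i c (α · ν) (f₊|_Σ - f₋|_Σ) + (1/2) (η I₄ + τ β) (f₊|_Σ + f₋|_Σ) = 0` on `Σ`. -/
def Coupling (Ω : Opens Space) (c η τ : ℝ) (gp gm : L2Surface (surface Ω)) : Prop :=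
  ∀ᵐ x ∂(surfaceMeasure (surface Ω)),
    ((Complex.I * c) • alphaNu Ω x) *ᵥ ((gp x).ofLp - (gm x).ofLp)
      + ((1 / 2 : ℂ) • strength η τ) *ᵥ ((gp x).ofLp + (gm x).ofLp) = 0

theorem Coupling.add {Ω : Opens Space} {c η τ : ℝ} {gp gm gp' gm' : L2Surface (surface Ω)}
    (h : Coupling Ω c η τ gp gm) (h' : Coupling Ω c η τ gp' gm') :
    Coupling Ω c η τ (gp + gp') (gm + gm') := by
  filter_upwards [h, h', Lp.coeFn_add gp gp', Lp.coeFn_add gm gm'] with x h1 h2 h3 h4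
  rw [h3, h4, Pi.add_apply, Pi.add_apply, WithLp.ofLp_add, WithLp.ofLp_add, add_sub_add_comm,
    add_add_add_comm (gp x).ofLp, Matrix.mulVec_add, Matrix.mulVec_add, add_add_add_comm, h1, h2,
    add_zero]

theorem Coupling.smul {Ω : Opens Space} {c η τ : ℝ} {gp gm : L2Surface (surface Ω)} (a : ℂ)
    (h : Coupling Ω c η τ gp gm) : Coupling Ω c η τ (a • gp) (a • gm) := by
  filter_upwards [h, Lp.coeFn_smul a gp, Lp.coeFn_smul a gm] with x h1 h3 h4
  rw [h3, h4, Pi.smul_apply, Pi.smul_apply, WithLp.ofLp_smul, WithLp.ofLp_smul, ← smul_sub,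
    ← smul_add, Matrix.mulVec_smul, Matrix.mulVec_smul, ← smul_add, h1, smul_zero]

theorem Coupling.zero (Ω : Opens Space) (c η τ : ℝ) : Coupling Ω c η τ 0 0 := by
  filter_upwards [Lp.coeFn_zero Spinor 2 (surfaceMeasure (surface Ω))] with x h1
  simp only [h1, Pi.zero_apply, WithLp.ofLp_zero, sub_zero, add_zero, Matrix.mulVec_zero]

/-- The domain of `A_{η,τ}`: all `f = f₊ ⊕ f₋ ∈ H¹(Ω₊)⁴ ⊕ H¹(Ω₋)⁴` whose traces satisfy the
coupling condition. -/
def shellDomain (Ω : Opens Space) (c η τ : ℝ) : Submodule ℂ (L2 volume) where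
  carrier := {f | ∃ h : f ∈ brokenH1 Ω,
    Coupling Ω c η τ (tracePlus Ω ⟨f, h⟩) (traceMinus Ω ⟨f, h⟩)}
  add_mem' := by
    rintro f f' ⟨h, hB⟩ ⟨h', hB'⟩
    refine ⟨add_mem h h', ?_⟩
    have e : (⟨f + f', add_mem h h'⟩ : brokenH1 Ω) = ⟨f, h⟩ + ⟨f', h'⟩ := rfl
    rw [e, map_add, map_add]
    exact hB.add hB'
  zero_mem' := by
    refine ⟨zero_mem _, ?_⟩
    have e : (⟨0, zero_mem _⟩ : brokenH1 Ω) = 0 := rfl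
    rw [e, map_zero, map_zero]
    exact Coupling.zero Ω c η τ
  smul_mem' := by
    rintro a f ⟨h, hB⟩
    refine ⟨Submodule.smul_mem _ a h, ?_⟩
    have e : (⟨a • f, Submodule.smul_mem _ a h⟩ : brokenH1 Ω) = a • ⟨f, h⟩ := rfl
    rw [e, map_smul, map_smul]
    exact hB.smul a

theorem shellDomain_le (Ω : Opens Space) (c η τ : ℝ) : shellDomain Ω c η τ ≤ brokenH1 Ω :=
  fun _ hf => hf.1

/-- The map `f ↦ (-i c α · ∇ + m c² β) f₊ ⊕ (-i c α · ∇ + m c² β) f₋`. -/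
def brokenDirac (Ω : Opens Space) (m c : ℝ) : brokenH1 Ω →ₗ[ℂ] L2 volume where
  toFun f := glue Ω (diracExpr Ω m c (plusPart Ω f)) (diracExpr (exterior Ω) m c (minusPart Ω f))
  map_add' f f' := by
    simp only [glue, map_add]
    abel
  map_smul' a f := by
    simp only [glue, map_smul, smul_add, RingHom.id_apply]

/-- The operator `A_{η,τ}` in `L²(ℝ³)⁴`. -/
def shellDirac (Ω : Opens Space) (m c η τ : ℝ) : L2 volume →ₗ.[ℂ] L2 volume where
  domain := shellDomain Ω c η τ
  toFun := brokenDirac Ω m c ∘ₗ Submodule.inclusion (shellDomain_le Ω c η τ)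

/-- The matrix `i c (α · ν) + (1/2) (η I₄ + τ β)` at `x ∈ Σ`. -/
def couplingPlus (Ω : Opens Space) (c η τ : ℝ) (x : Space) : Mat4 :=
  (Complex.I * c) • alphaNu Ω x + (1 / 2 : ℂ) • strength η τ

/-- The matrix `-i c (α · ν) + (1/2) (η I₄ + τ β)` at `x ∈ Σ`. -/
def couplingMinus (Ω : Opens Space) (c η τ : ℝ) (x : Space) : Mat4 :=
  -((Complex.I * c) • alphaNu Ω x) + (1 / 2 : ℂ) • strength η τ

/-- The matrix `R_{η,τ} = -(i c (α·ν) + (η I₄ + τ β)/2)⁻¹ (-i c (α·ν) + (η I₄ + τ β)/2)` at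
`x ∈ Σ`. -/
def transmission (Ω : Opens Space) (c η τ : ℝ) (x : Space) : Mat4 :=
  -((couplingPlus Ω c η τ x)⁻¹ * couplingMinus Ω c η τ x)

/-- The matrix `2 c I₄ - i (α · ν) (η I₄ + τ β)` at `x ∈ Σ`. -/
def confinePlus (Ω : Opens Space) (c η τ : ℝ) (x : Space) : Mat4 :=
  (2 * c : ℂ) • (1 : Mat4) - Complex.I • (alphaNu Ω x * strength η τ)

/-- The matrix `2 c I₄ + i (α · ν) (η I₄ + τ β)` at `x ∈ Σ`. -/
def confineMinus (Ω : Opens Space) (c η τ : ℝ) (x : Space) : Mat4 :=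
  (2 * c : ℂ) • (1 : Mat4) + Complex.I • (alphaNu Ω x * strength η τ)

/-- The matrix `I₄ + i β (α · ν)` of the MIT bag boundary condition for `Ω₊`. -/
def mitPlus (Ω : Opens Space) (x : Space) : Mat4 :=
  1 + Complex.I • (diracBeta * alphaNu Ω x)

/-- The matrix `I₄ - i β (α · ν)` of the MIT bag boundary condition for `Ω₋`, whose outward normal
is `-ν`. -/
def mitMinus (Ω : Opens Space) (x : Space) : Mat4 :=
  1 - Complex.I • (diracBeta * alphaNu Ω x)

end DeltaShell

end

open DeltaShell

open DeltaShell

namespace DeltaShell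

open MeasureTheory TopologicalSpace
open scoped Matrix Gradient

/-! ### The algebra of the Dirac matrices -/

/-! Everything reduces to linear algebra in the two boundary values at almost every point of the
surface. Write `N` for `α · ν`, `S` for `η I₄ + τ β` and `S'` for `η I₄ - τ β`. Three relations
suffice: `N² = 1` because `ν` is a unit vector, `S N = N S'` because `β` anticommutes with each
`αⱼ`, and `S S' = S' S = η² - τ²`. The coupling condition for boundary values `u`, `v` reads `P u +
M v = 0` with `P = i c N + S/2` and `M = -i c N + S/2`.

Since `P (-i c N + S'/2) = c² + (η² - τ²)/4` (`couplingPlus_mul`), `P` is invertible away from the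
critical value. So is `M`, which is `P` with `c` replaced by `-c`, and the condition can be solved
for `u`.

At the critical value `(N S)² = -4c²`, so `2c ∓ i N S` have product zero and sum `4c`: divided by
`4c`, they are complementary projections. Up to invertible factors they are `P` and `M`, and the
coupling condition says that the two images `(2c - i N S) u` and `(2c + i N S) v` agree.
Complementary projections have ranges meeting only in zero, so both vanish and the condition
decouples (`coupling_iff_confine`). The operators then have equal domains and the same action on
each side. -/

theorem alphaDot_eq (x : Space) :
    alphaDot x = !![0, 0, (x 2 : ℂ), x 0 - Complex.I * x 1;
      0, 0, x 0 + Complex.I * x 1, -(x 2 : ℂ);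
      (x 2 : ℂ), x 0 - Complex.I * x 1, 0, 0;
      x 0 + Complex.I * x 1, -(x 2 : ℂ), 0, 0] := by
  ext i j
  fin_cases i <;> fin_cases j <;>
    simp [alphaDot, Fin.sum_univ_three, diracAlpha, pauli, finSumFinEquiv, Fin.addCases,
      Matrix.fromBlocks, Matrix.sum_apply] <;> ring

theorem diracBeta_eq :
    diracBeta = !![1, 0, 0, 0; 0, 1, 0, 0; 0, 0, -1, 0; 0, 0, 0, -1] := by
  ext i j
  fin_cases i <;> fin_cases j <;>
    simp [diracBeta, finSumFinEquiv, Fin.addCases, Matrix.fromBlocks]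

theorem diracBeta_mul_self : diracBeta * diracBeta = 1 := by
  rw [diracBeta_eq]
  ext i j
  fin_cases i <;> fin_cases j <;> simp [Matrix.mul_apply, Fin.sum_univ_four]

theorem diracBeta_mul_alphaDot (x : Space) :
    diracBeta * alphaDot x = -(alphaDot x * diracBeta) := by
  rw [diracBeta_eq, alphaDot_eq]
  ext i j
  fin_cases i <;> fin_cases j <;> simp [Matrix.mul_apply, Fin.sum_univ_four]

theorem alphaDot_mul_self (x : Space) :
    alphaDot x * alphaDot x = ((‖x‖ ^ 2 : ℝ) : ℂ) • (1 : Mat4) := by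
  rw [EuclideanSpace.real_norm_sq_eq, Fin.sum_univ_three, alphaDot_eq]
  ext i j
  fin_cases i <;> fin_cases j <;> simp [Matrix.mul_apply, Fin.sum_univ_four] <;>
    -- The diagonal entries contain `(x₀ - i x₁)(x₀ + i x₁)`, which needs `i² = -1`.
    first | ring1 | linear_combination (-(x 1 : ℂ) ^ 2) * Complex.I_sq

/-- Anticommutation with `β` turns `τ` into `-τ`; this is the only commutation rule needed between
the normal and the interaction strength. -/
theorem strength_mul_alphaDot (η τ : ℝ) (x : Space) :
    strength η τ * alphaDot x = alphaDot x * strength η (-τ) := by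
  simp only [strength, add_mul, mul_add, smul_mul_assoc, mul_smul_comm, one_mul, mul_one,
    diracBeta_mul_alphaDot, Complex.ofReal_neg, neg_smul, smul_neg, mul_neg]

theorem strength_mul_strength_neg (η τ : ℝ) :
    strength η τ * strength η (-τ) = ((η ^ 2 - τ ^ 2 : ℝ) : ℂ) • (1 : Mat4) := by
  simp only [strength, add_mul, mul_add, smul_mul_assoc, mul_smul_comm, one_mul, mul_one,
    diracBeta_mul_self]
  push_cast
  module

theorem strength_neg_mul_strength (η τ : ℝ) :
    strength η (-τ) * strength η τ = ((η ^ 2 - τ ^ 2 : ℝ) : ℂ) • (1 : Mat4) := by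
  simpa using strength_mul_strength_neg η (-τ)

/-! ### The normal vector on the boundary -/

theorem IsOutwardUnitNormal.norm_eq_one {Ω : Set Space} {x n : Space}
    (h : IsOutwardUnitNormal Ω x n) : ‖n‖ = 1 := by
  obtain ⟨U, φ, hφ, rfl⟩ := h
  simp [norm_smul, hφ.gradient_ne_zero x hφ.mem]

/-- Every candidate normal is a normalized nonzero gradient, so the chosen one has length one
whichever it is; uniqueness plays no role. -/
theorem IsBoundedC2Domain.norm_outwardNormal {Ω : Opens Space} (hΩ : IsBoundedC2Domain Ω)
    {x : Space} (hx : x ∈ surface Ω) : ‖outwardNormal Ω x‖ = 1 := by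
  have h : ∃ n, IsOutwardUnitNormal Ω x n := by
    obtain ⟨U, φ, hφ⟩ := hΩ.smooth_boundary x hx
    exact ⟨_, U, φ, hφ, rfl⟩
  rw [outwardNormal, dif_pos h]
  exact h.choose_spec.norm_eq_one

theorem IsBoundedC2Domain.alphaNu_mul_self {Ω : Opens Space} (hΩ : IsBoundedC2Domain Ω)
    {x : Space} (hx : x ∈ surface Ω) : alphaNu Ω x * alphaNu Ω x = 1 := by
  rw [alphaNu, alphaDot_mul_self, hΩ.norm_outwardNormal hx]
  simp

theorem ae_mem_surface (Ω : Opens Space) :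
    ∀ᵐ x ∂(surfaceMeasure (surface Ω)), x ∈ surface Ω :=
  ae_restrict_mem isClosed_frontier.measurableSet

/-! ### The coupling matrices -/

theorem alphaNu_mul_strength_mul_self {Ω : Opens Space} {x : Space}
    (hN : alphaNu Ω x * alphaNu Ω x = 1) (η τ : ℝ) :
    (alphaNu Ω x * strength η τ) * (alphaNu Ω x * strength η τ)
      = ((η ^ 2 - τ ^ 2 : ℝ) : ℂ) • (1 : Mat4) := by
  have h : strength η τ * alphaNu Ω x = alphaNu Ω x * strength η (-τ) :=
    strength_mul_alphaDot η τ _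
  calc (alphaNu Ω x * strength η τ) * (alphaNu Ω x * strength η τ)
      = alphaNu Ω x * (strength η τ * alphaNu Ω x) * strength η τ := by noncomm_ring
    _ = (alphaNu Ω x * alphaNu Ω x) * (strength η (-τ) * strength η τ) := by
      rw [h]; noncomm_ring
    _ = _ := by rw [hN, one_mul, strength_neg_mul_strength]

theorem couplingMinus_eq (Ω : Opens Space) (c η τ : ℝ) (x : Space) :
    couplingMinus Ω c η τ x = couplingPlus Ω (-c) η τ x := by
  simp [couplingMinus, couplingPlus]

/-- The second factor carries the opposite signs of `c` and `τ`, so that the two cross terms cancel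
by the commutation rule and only scalars remain. -/
theorem couplingPlus_mul {Ω : Opens Space} {x : Space}
    (hN : alphaNu Ω x * alphaNu Ω x = 1) (c η τ : ℝ) :
    couplingPlus Ω c η τ x * couplingMinus Ω c η (-τ) x
      = ((c ^ 2 + (η ^ 2 - τ ^ 2) / 4 : ℝ) : ℂ) • (1 : Mat4) := by
  have h : strength η τ * alphaNu Ω x = alphaNu Ω x * strength η (-τ) :=
    strength_mul_alphaDot η τ _
  simp only [couplingPlus, couplingMinus, add_mul, mul_add, mul_neg, smul_mul_assoc,
    mul_smul_comm, hN, h, strength_mul_strength_neg]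
  push_cast
  match_scalars <;> first | ring1 | linear_combination (-(c : ℂ) ^ 2) * Complex.I_sq

theorem isUnit_couplingPlus {Ω : Opens Space} {x : Space}
    (hN : alphaNu Ω x * alphaNu Ω x = 1) {c η τ : ℝ} (h : η ^ 2 - τ ^ 2 ≠ -4 * c ^ 2) :
    IsUnit (couplingPlus Ω c η τ x) := by
  have h0 : ((c ^ 2 + (η ^ 2 - τ ^ 2) / 4 : ℝ) : ℂ) ≠ 0 := by
    refine Complex.ofReal_ne_zero.2 fun h0 => h ?_
    linarith
  refine IsUnit.of_mul_eq_one
    (((c ^ 2 + (η ^ 2 - τ ^ 2) / 4 : ℝ) : ℂ)⁻¹ • couplingMinus Ω c η (-τ) x) ?_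
  rw [mul_smul_comm, couplingPlus_mul hN, smul_smul, inv_mul_cancel₀ h0, one_smul]

theorem isUnit_couplingMinus {Ω : Opens Space} {x : Space}
    (hN : alphaNu Ω x * alphaNu Ω x = 1) {c η τ : ℝ} (h : η ^ 2 - τ ^ 2 ≠ -4 * c ^ 2) :
    IsUnit (couplingMinus Ω c η τ x) := by
  rw [couplingMinus_eq]
  -- The critical value depends on `c` only through `c²`.
  exact isUnit_couplingPlus hN (by rwa [neg_sq])

theorem isUnit_transmission {Ω : Opens Space} {x : Space}
    (hN : alphaNu Ω x * alphaNu Ω x = 1) {c η τ : ℝ} (h : η ^ 2 - τ ^ 2 ≠ -4 * c ^ 2) :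
    IsUnit (transmission Ω c η τ x) :=
  ((Matrix.isUnit_nonsing_inv_iff.2 (isUnit_couplingPlus hN h)).mul
    (isUnit_couplingMinus hN h)).neg

theorem coupling_eq (Ω : Opens Space) (c η τ : ℝ) (x : Space) (u v : Fin 4 → ℂ) :
    ((Complex.I * c) • alphaNu Ω x) *ᵥ (u - v) + ((1 / 2 : ℂ) • strength η τ) *ᵥ (u + v)
      = couplingPlus Ω c η τ x *ᵥ u + couplingMinus Ω c η τ x *ᵥ v := by
  simp only [couplingPlus, couplingMinus, Matrix.add_mulVec, Matrix.neg_mulVec,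
    Matrix.mulVec_add, Matrix.mulVec_sub]
  abel

theorem coupling_iff_transmission {Ω : Opens Space} {x : Space}
    (hN : alphaNu Ω x * alphaNu Ω x = 1) {c η τ : ℝ} (h : η ^ 2 - τ ^ 2 ≠ -4 * c ^ 2)
    (u v : Fin 4 → ℂ) :
    couplingPlus Ω c η τ x *ᵥ u + couplingMinus Ω c η τ x *ᵥ v = 0 ↔
      u = transmission Ω c η τ x *ᵥ v := by
  have hP := (Matrix.isUnit_iff_isUnit_det _).1 (isUnit_couplingPlus hN h)
  constructor
  · intro e
    have e' := congrArg ((couplingPlus Ω c η τ x)⁻¹ *ᵥ ·) e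
    simp only [Matrix.mulVec_add, Matrix.mulVec_mulVec, Matrix.nonsing_inv_mul _ hP,
      Matrix.one_mulVec, Matrix.mulVec_zero] at e'
    rw [transmission, Matrix.neg_mulVec]
    exact eq_neg_of_add_eq_zero_left e'
  · rintro rfl
    rw [transmission, Matrix.neg_mulVec, Matrix.mulVec_neg, Matrix.mulVec_mulVec, ← mul_assoc,
      Matrix.mul_nonsing_inv _ hP, one_mul, neg_add_cancel]

/-! ### Complementary projections at the critical value. -/

theorem confinePlus_eq {Ω : Opens Space} {x : Space}
    (hN : alphaNu Ω x * alphaNu Ω x = 1) (c η τ : ℝ) :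
    confinePlus Ω c η τ x = (-2 * Complex.I) • (alphaNu Ω x * couplingPlus Ω c η τ x) := by
  simp only [confinePlus, couplingPlus, mul_add, mul_smul_comm, hN]
  match_scalars <;> first | ring1 | linear_combination (2 * (c : ℂ)) * Complex.I_sq

theorem confineMinus_eq {Ω : Opens Space} {x : Space}
    (hN : alphaNu Ω x * alphaNu Ω x = 1) (c η τ : ℝ) :
    confineMinus Ω c η τ x = (2 * Complex.I) • (alphaNu Ω x * couplingMinus Ω c η τ x) := by
  simp only [confineMinus, couplingMinus, mul_add, mul_neg, mul_smul_comm, hN]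
  match_scalars <;> first | ring1 | linear_combination (2 * (c : ℂ)) * Complex.I_sq

/-- Inverts `confinePlus_eq`: `N` is its own inverse and `(i/2)(-2i) = 1`. -/
theorem couplingPlus_eq {Ω : Opens Space} {x : Space}
    (hN : alphaNu Ω x * alphaNu Ω x = 1) (c η τ : ℝ) :
    couplingPlus Ω c η τ x = (Complex.I / 2) • (alphaNu Ω x * confinePlus Ω c η τ x) := by
  rw [confinePlus_eq hN, mul_smul_comm, ← mul_assoc, hN, one_mul, smul_smul]
  match_scalars
  linear_combination Complex.I_sq

theorem couplingMinus_eq_confineMinus {Ω : Opens Space} {x : Space}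
    (hN : alphaNu Ω x * alphaNu Ω x = 1) (c η τ : ℝ) :
    couplingMinus Ω c η τ x = (-(Complex.I / 2)) • (alphaNu Ω x * confineMinus Ω c η τ x) := by
  rw [confineMinus_eq hN, mul_smul_comm, ← mul_assoc, hN, one_mul, smul_smul]
  match_scalars
  linear_combination Complex.I_sq

theorem confinePlus_mul_confineMinus {Ω : Opens Space} {x : Space}
    (hN : alphaNu Ω x * alphaNu Ω x = 1) {c η τ : ℝ} (h : η ^ 2 - τ ^ 2 = -4 * c ^ 2) :
    confinePlus Ω c η τ x * confineMinus Ω c η τ x = 0 := by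
  simp only [confinePlus, confineMinus, sub_mul, mul_add, smul_mul_assoc, mul_smul_comm,
    one_mul, mul_one, alphaNu_mul_strength_mul_self hN, h]
  push_cast
  match_scalars <;> first | ring1 | linear_combination (4 * (c : ℂ) ^ 2) * Complex.I_sq

theorem confinePlus_add_confineMinus (Ω : Opens Space) (c η τ : ℝ) (x : Space) :
    confinePlus Ω c η τ x + confineMinus Ω c η τ x = (4 * c : ℂ) • (1 : Mat4) := by
  simp only [confinePlus, confineMinus]
  module

theorem coupling_iff_confine {Ω : Opens Space} {x : Space}
    (hN : alphaNu Ω x * alphaNu Ω x = 1) {c η τ : ℝ} (hc : c ≠ 0)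
    (h : η ^ 2 - τ ^ 2 = -4 * c ^ 2) (u v : Fin 4 → ℂ) :
    couplingPlus Ω c η τ x *ᵥ u + couplingMinus Ω c η τ x *ᵥ v = 0 ↔
      confinePlus Ω c η τ x *ᵥ u = 0 ∧ confineMinus Ω c η τ x *ᵥ v = 0 := by
  constructor
  · intro e
    have e1 : confinePlus Ω c η τ x *ᵥ u = confineMinus Ω c η τ x *ᵥ v := by
      -- The factor `-2i N` turns the first coupling matrix into `confinePlus` and the second into
      -- `-confineMinus`.
      have e' := congrArg (fun w => (-2 * Complex.I) • (alphaNu Ω x *ᵥ w)) e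
      simp only [Matrix.mulVec_add, Matrix.mulVec_mulVec, Matrix.mulVec_zero, smul_zero, smul_add,
        ← Matrix.smul_mulVec] at e'
      rw [← confinePlus_eq hN, neg_mul, neg_smul, ← confineMinus_eq hN, Matrix.neg_mulVec] at e'
      exact sub_eq_zero.1 ((sub_eq_add_neg _ _).trans e')
    have e2 : confinePlus Ω c η τ x *ᵥ u = 0 := by
      -- Multiplying the sum `4c` by `confinePlus` leaves only the square, since the mixed product
      -- is zero.
      have hsq : confinePlus Ω c η τ x * confinePlus Ω c η τ x
          = (4 * c : ℂ) • confinePlus Ω c η τ x := by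
        have e3 := congrArg (confinePlus Ω c η τ x * ·) (confinePlus_add_confineMinus Ω c η τ x)
        simpa only [mul_add, confinePlus_mul_confineMinus hN h, add_zero, mul_smul_comm, mul_one]
          using e3
      -- Applying `confinePlus` to `e1` multiplies the left side by `4c ≠ 0` and annihilates the
      -- right side.
      have e4 := congrArg (confinePlus Ω c η τ x *ᵥ ·) e1
      simp only [Matrix.mulVec_mulVec, hsq, confinePlus_mul_confineMinus hN h, Matrix.zero_mulVec,
        Matrix.smul_mulVec] at e4
      exact (smul_eq_zero.1 e4).resolve_left (by simp [hc])
    exact ⟨e2, e1 ▸ e2⟩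
  · rintro ⟨e1, e2⟩
    rw [couplingPlus_eq hN, couplingMinus_eq_confineMinus hN, Matrix.smul_mulVec,
      Matrix.smul_mulVec, ← Matrix.mulVec_mulVec, ← Matrix.mulVec_mulVec, e1, e2]
    simp

/-! ### The MIT bag matrices -/

/-- Moving `β` to the left of `α · ν` produces the sign, which is why the bag condition inside
carries `+i` where `confinePlus` carries `-i`. -/
theorem alphaNu_mul_strength_bag (Ω : Opens Space) (c : ℝ) (x : Space) :
    alphaNu Ω x * strength 0 (2 * c) = -((2 * c : ℂ) • (diracBeta * alphaNu Ω x)) := by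
  rw [alphaNu, diracBeta_mul_alphaDot]
  simp [strength]

theorem confinePlus_bag (Ω : Opens Space) (c : ℝ) (x : Space) :
    confinePlus Ω c 0 (2 * c) x = (2 * c : ℂ) • mitPlus Ω x := by
  rw [confinePlus, mitPlus, alphaNu_mul_strength_bag]
  module

theorem confineMinus_bag (Ω : Opens Space) (c : ℝ) (x : Space) :
    confineMinus Ω c 0 (2 * c) x = (2 * c : ℂ) • mitMinus Ω x := by
  rw [confineMinus, mitMinus, alphaNu_mul_strength_bag]
  module

theorem boundaryCondition_const_smul {S : Set Space} {B : Space → Mat4} {g : L2Surface S}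
    {a : ℂ} (ha : a ≠ 0) :
    BoundaryCondition S (fun x => a • B x) g ↔ BoundaryCondition S B g := by
  simp only [BoundaryCondition, Matrix.smul_mulVec, smul_eq_zero, ha, false_or]

theorem boundaryDirac_apply (Ω : Opens Space) (S : Set Space) (m c : ℝ) (B : Space → Mat4)
    (f : (boundaryDirac Ω S m c B).domain) :
    boundaryDirac Ω S m c B f = diracExpr Ω m c ⟨f, boundaryDomain_le Ω S B f.2⟩ :=
  rfl

theorem boundaryDomain_const_smul (Ω : Opens Space) (S : Set Space) (B : Space → Mat4)
    {a : ℂ} (ha : a ≠ 0) :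
    boundaryDomain Ω S (fun x => a • B x) = boundaryDomain Ω S B :=
  Submodule.ext fun _ => exists_congr fun _ => boundaryCondition_const_smul ha

/-- The boundary matrix enters only through the domain, and a nonzero scalar does not change its
kernel. -/
theorem boundaryDirac_const_smul (Ω : Opens Space) (S : Set Space) (m c : ℝ) (B : Space → Mat4)
    {a : ℂ} (ha : a ≠ 0) :
    boundaryDirac Ω S m c (fun x => a • B x) = boundaryDirac Ω S m c B := by
  refine LinearPMap.ext (boundaryDomain_const_smul Ω S B ha) fun f _ _ => ?_
  rw [boundaryDirac_apply, boundaryDirac_apply]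

/-! ### The domain of the shell operator -/

theorem mem_shellDirac_domain (Ω : Opens Space) (m c η τ : ℝ) (f : brokenH1 Ω) :
    (f : L2 volume) ∈ (shellDirac Ω m c η τ).domain ↔
      Coupling Ω c η τ (tracePlus Ω f) (traceMinus Ω f) :=
  ⟨fun ⟨_, h⟩ => h, fun h => ⟨f.2, h⟩⟩

theorem mem_shellDirac_domain_iff_transmission {Ω : Opens Space} (hΩ : IsBoundedC2Domain Ω)
    (m : ℝ) {c η τ : ℝ} (h : η ^ 2 - τ ^ 2 ≠ -4 * c ^ 2) (f : brokenH1 Ω) :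
    (f : L2 volume) ∈ (shellDirac Ω m c η τ).domain ↔
      ∀ᵐ x ∂(surfaceMeasure (surface Ω)),
        (tracePlus Ω f x).ofLp = transmission Ω c η τ x *ᵥ (traceMinus Ω f x).ofLp := by
  rw [mem_shellDirac_domain]
  refine Filter.eventually_congr ?_
  -- The matrix equivalence needs `N² = 1`, known only at points of the surface.
  filter_upwards [ae_mem_surface Ω] with x hx
  rw [coupling_eq, coupling_iff_transmission (hΩ.alphaNu_mul_self hx) h]

theorem mem_shellDirac_domain_iff_confine {Ω : Opens Space} (hΩ : IsBoundedC2Domain Ω)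
    (m : ℝ) {c η τ : ℝ} (hc : c ≠ 0) (h : η ^ 2 - τ ^ 2 = -4 * c ^ 2) (f : brokenH1 Ω) :
    (f : L2 volume) ∈ (shellDirac Ω m c η τ).domain ↔
      BoundaryCondition (surface Ω) (confinePlus Ω c η τ) (tracePlus Ω f) ∧
      BoundaryCondition (surface Ω) (confineMinus Ω c η τ) (traceMinus Ω f) := by
  rw [mem_shellDirac_domain, BoundaryCondition, BoundaryCondition, ← Filter.eventually_and]
  refine Filter.eventually_congr ?_
  filter_upwards [ae_mem_surface Ω] with x hx
  rw [coupling_eq, coupling_iff_confine (hΩ.alphaNu_mul_self hx) hc h]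

theorem shellDirac_eq_orthogonalSum {Ω : Opens Space} (hΩ : IsBoundedC2Domain Ω)
    (m : ℝ) {c η τ : ℝ} (hc : c ≠ 0) (h : η ^ 2 - τ ^ 2 = -4 * c ^ 2) :
    shellDirac Ω m c η τ = orthogonalSum Ω
      (boundaryDirac Ω (surface Ω) m c (confinePlus Ω c η τ))
      (boundaryDirac (exterior Ω) (surface Ω) m c (confineMinus Ω c η τ)) := by
  refine LinearPMap.ext ?_ ?_
  · refine Submodule.ext fun f => ⟨fun hf => ?_, ?_⟩
    · have hf' : f ∈ brokenH1 Ω := hf.1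
      obtain ⟨h1, h2⟩ := (mem_shellDirac_domain_iff_confine hΩ m hc h ⟨f, hf'⟩).1 hf
      exact ⟨⟨hf'.1, h1⟩, ⟨hf'.2, h2⟩⟩
    · rintro ⟨⟨h1, b1⟩, ⟨h2, b2⟩⟩
      exact (mem_shellDirac_domain_iff_confine hΩ m hc h ⟨f, h1, h2⟩).2 ⟨b1, b2⟩
  · intro f _ _
    -- Both operators glue the same differential expression applied to the two restrictions of `f`.
    rfl

end DeltaShell

theorem lemma3p1 (Ω : TopologicalSpace.Opens Space) (hΩ : IsBoundedC2Domain Ω)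
    (m c : ℝ) (hm : 0 < m) (hc : 0 < c) (η τ : ℝ) :
    -- (i) the non-confining case
    (η ^ 2 - τ ^ 2 ≠ -4 * c ^ 2 →
      (∀ x ∈ surface Ω, IsUnit (couplingPlus Ω c η τ x) ∧ IsUnit (transmission Ω c η τ x)) ∧
      ∀ f : brokenH1 Ω, (f : L2 MeasureTheory.volume) ∈ (shellDirac Ω m c η τ).domain ↔
        ∀ᵐ x ∂(surfaceMeasure (surface Ω)),
          (tracePlus Ω f x).ofLp = transmission Ω c η τ x *ᵥ (traceMinus Ω f x).ofLp) ∧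
    -- (ii) the confining case
    (η ^ 2 - τ ^ 2 = -4 * c ^ 2 →
      (∀ f : brokenH1 Ω, (f : L2 MeasureTheory.volume) ∈ (shellDirac Ω m c η τ).domain ↔
        BoundaryCondition (surface Ω) (confinePlus Ω c η τ) (tracePlus Ω f) ∧
        BoundaryCondition (surface Ω) (confineMinus Ω c η τ) (traceMinus Ω f)) ∧
      shellDirac Ω m c η τ = orthogonalSum Ω
        (boundaryDirac Ω (surface Ω) m c (confinePlus Ω c η τ))
        (boundaryDirac (exterior Ω) (surface Ω) m c (confineMinus Ω c η τ))) ∧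
    -- the MIT bag case `η = 0`, `τ = 2 c`
    ((∀ f : brokenH1 Ω, (f : L2 MeasureTheory.volume) ∈ (shellDirac Ω m c 0 (2 * c)).domain ↔
        BoundaryCondition (surface Ω) (mitPlus Ω) (tracePlus Ω f) ∧
        BoundaryCondition (surface Ω) (mitMinus Ω) (traceMinus Ω f)) ∧
      shellDirac Ω m c 0 (2 * c) = orthogonalSum Ω
        (boundaryDirac Ω (surface Ω) m c (mitPlus Ω))
        (boundaryDirac (exterior Ω) (surface Ω) m c (mitMinus Ω))) := by
  -- The bag parameters are critical, so the confining case applies; its matrices are `2c` times the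
  -- bag matrices.
  have hbag : (0 : ℝ) ^ 2 - (2 * c) ^ 2 = -4 * c ^ 2 := by ring
  have ha : (2 * c : ℂ) ≠ 0 := by simp [hc.ne']
  have e1 : confinePlus Ω c 0 (2 * c) = fun x => (2 * c : ℂ) • mitPlus Ω x :=
    funext (confinePlus_bag Ω c)
  have e2 : confineMinus Ω c 0 (2 * c) = fun x => (2 * c : ℂ) • mitMinus Ω x :=
    funext (confineMinus_bag Ω c)
  refine ⟨fun h => ⟨fun x hx => ?_, mem_shellDirac_domain_iff_transmission hΩ m h⟩,
    fun h => ⟨mem_shellDirac_domain_iff_confine hΩ m hc.ne' h,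
      shellDirac_eq_orthogonalSum hΩ m hc.ne' h⟩, fun f => ?_, ?_⟩
  · have hN := hΩ.alphaNu_mul_self hx
    exact ⟨isUnit_couplingPlus hN h, isUnit_transmission hN h⟩
  · rw [mem_shellDirac_domain_iff_confine hΩ m hc.ne' hbag, e1, e2,
      boundaryCondition_const_smul ha, boundaryCondition_const_smul ha]
  · rw [shellDirac_eq_orthogonalSum hΩ m hc.ne' hbag, e1, e2, boundaryDirac_const_smul _ _ _ _ _ ha,
      boundaryDirac_const_smul _ _ _ _ _ ha]
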